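/- Let $a<b$ be real numbers. A Banach function lattice $X$ on $[a,b]$ (with Lebesgue measure $\mu$) is a complex vector space of measurable functions $f:[a,b]\to\mathbb{C}$, with functions equal almost everywhere identified, that contains $|f|$ together with $f$, is contained in $L_1[a,b]$, contains the indicator function of every measurable subset of $[a,b]$, and is complete with respect to a norm $\|\cdot\|_X$ such that $\|f\|_X\le\|g\|_X$ whenever $f,g\in X$ and $|f|\le|g|$ almost everywhere. It is called rearrangement invariant if $\|f\|_X=\|g\|_X$ whenever $f,g\in X$ and $\mu\{x:|f(x)|\ge y\}=\mu\{x:|g(x)|\ge y\}$ for all $y$. Let $\mathcal{P}_n$ be the set of algebraic polynomials of degree at most $n$ with complex coefficients. **(Markov inequality.)** Let $X$ be a rearrangement invariant Banach function lattice on $[a,b]$ and let $n,r\ge 0$ be integers. Then every $P\in\mathcal{P}_n$ satisfies $P,P^{(r)}\in X$ and $$\|P^{(r)}\|_X\le\left(\frac{8n^2}{b-a}\right)^r\|P\|_X,$$ where $0^0=1$. **(Marcinkiewicz–Zygmund inequality.)** For every $\varepsilon>0$ there is a constant $C>0$, depending only on $\varepsilon$, with the following property. Let $a<b$, let $X$ be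 a rearrangement invariant Banach function lattice on $[a,b]$, let $n\ge 0$ and $N\ge 1$ be integers with $N\ge\left(\frac{8}{\log 2}+\varepsilon\right)n^2$, and let $x_k$ be an arbitrary point of $\Omega_k=\left[a+\frac{(b-a)(k-1)}{N},\,a+\frac{(b-a)k}{N}\right]$, $k=1,\dots,N$. Then for every $P\in\mathcal{P}_n$ the functions $P$ and $\sum_{k=1}^N|P(x_k)|\chi_{\Omega_k}$ belong to $X$ and $$C^{-1}\Big\|\sum_{k=1}^N|P(x_k)|\chi_{\Omega_k}\Big\|_X\le\|P\|_X\le C\,\Big\|\sum_{k=1}^N|P(x_k)|\chi_{\Omega_k}\Big\|_X.$$ -/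

import Mathlib

open MeasureTheory Set

/-- A Banach function lattice `X = X(Ω, μ)` of complex-valued measurable functions, where functions
that agree `μ`-almost everywhere are identified. The norm `nrm` is only meaningful on `carrier`;
its values outside `carrier` are irrelevant. -/
structure BanachFunctionLattice {Ω : Type*} [MeasurableSpace Ω] (μ : Measure Ω) where
  /-- The set of (classes of) functions that belong to `X`, a complex vector space. -/
  carrier : Submodule ℂ (Ω →ₘ[μ] ℂ)
  /-- The norm of `X`. -/
  nrm : (Ω →ₘ[μ] ℂ) → ℝ
  /-- `X` is a lattice: it contains `|f|` together with `f`. -/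
  abs_mem : ∀ f ∈ carrier,
    AEEqFun.comp (fun z : ℂ => ((‖z‖ : ℝ) : ℂ))
      (Complex.continuous_ofReal.comp continuous_norm) f ∈ carrier
  nrm_eq_zero_iff : ∀ f ∈ carrier, nrm f = 0 ↔ f = 0
  nrm_smul : ∀ (c : ℂ), ∀ f ∈ carrier, nrm (c • f) = ‖c‖ * nrm f
  nrm_add_le : ∀ f ∈ carrier, ∀ g ∈ carrier, nrm (f + g) ≤ nrm f + nrm g
  nrm_mono : ∀ f ∈ carrier, ∀ g ∈ carrier, (∀ᵐ x ∂μ, ‖f x‖ ≤ ‖g x‖) → nrm f ≤ nrm g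
  /-- `X` contains the indicator functions of all sets of finite measure. -/
  indicator_mem : ∀ (B : Set Ω) (hB : MeasurableSet B), μ B < ⊤ →
    AEEqFun.mk (B.indicator fun _ => (1 : ℂ))
      (stronglyMeasurable_const.indicator hB).aestronglyMeasurable ∈ carrier
  /-- `X` is contained in `L₁`. -/
  integrable : ∀ f ∈ carrier, Integrable f μ
  /-- `X` is complete. -/
  complete : ∀ u : ℕ → (Ω →ₘ[μ] ℂ), (∀ i, u i ∈ carrier) →
    (∀ δ : ℝ, 0 < δ → ∃ K : ℕ, ∀ i ≥ K, ∀ j ≥ K, nrm (u i - u j) < δ) →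
    ∃ g ∈ carrier, ∀ δ : ℝ, 0 < δ → ∃ K : ℕ, ∀ i ≥ K, nrm (u i - g) < δ

/-- `X` is rearrangement invariant: two elements `f, g` of `X` with the same distribution function
`y ↦ μ {x : |h x| ≥ y}` have the same norm. -/
def BanachFunctionLattice.RearrangementInvariant {Ω : Type*} [MeasurableSpace Ω] {μ : Measure Ω}
    (X : BanachFunctionLattice μ) : Prop :=
  ∀ f ∈ X.carrier, ∀ g ∈ X.carrier,
    (∀ y : ℝ, μ {x | y ≤ ‖f x‖} = μ {x | y ≤ ‖g x‖}) → X.nrm f = X.nrm g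

/-- Lebesgue measure on `[a, b]`. -/
noncomputable abbrev lebIcc (a b : ℝ) : Measure ℝ := volume.restrict (Icc a b)

/-- The function `x ↦ P x` on `[a, b]` given by a polynomial with complex coefficients. -/
noncomputable def polyFun (a b : ℝ) (P : Polynomial ℂ) : ℝ →ₘ[lebIcc a b] ℂ :=
  AEEqFun.mk (fun x : ℝ => P.eval (x : ℂ))
    (P.continuous.comp Complex.continuous_ofReal).aestronglyMeasurable

/-- The `k`-th of the `N` equal closed subintervals of `[a, b]`, `k = 1, …, N`. -/
def subInterval (a b : ℝ) (N k : ℕ) : Set ℝ :=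
  Icc (a + (b - a) * ((k : ℝ) - 1) / N) (a + (b - a) * (k : ℝ) / N)

/-- The step function `∑ k = 1, …, N, |P (x k)| χ_{Ω k}` on `[a, b]`. -/
noncomputable def sampleFun (a b : ℝ) (N : ℕ) (x : ℕ → ℝ) (P : Polynomial ℂ) :
    ℝ →ₘ[lebIcc a b] ℂ :=
  AEEqFun.mk
    (fun t : ℝ => ∑ k ∈ Finset.Icc 1 N,
      (subInterval a b N k).indicator (fun _ => ((‖P.eval (x k : ℂ)‖ : ℝ) : ℂ)) t)
    (Finset.stronglyMeasurable_fun_sum _ fun _ _ =>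
      stronglyMeasurable_const.indicator measurableSet_Icc).aestronglyMeasurable

/-! Markov: interpolating at the extremal points of the Chebyshev polynomial writes `h * P'(x)` as a
combination of values `P (x + h * t i)` with `t i ∈ [0, 1]` and coefficients of total size at most
`2 * n ^ 2`. On the left half of `[a, b]` take `h = (b - a) / 2`, on the right half `h = -(b - a) /
2`: every shifted half stays inside `[a, b]`, so by rearrangement invariance no cut-off translate
has larger norm than `P`. Each half contributes `4 * n ^ 2 / (b - a)`; add the halves and iterate
(`normOf_iterate_derivative_le`).

Marcinkiewicz–Zygmund: by Taylor's formula `|P|` and its sampled step function differ by at most `∑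
h ^ r / r! * |P^(r)|`, `r ≥ 1`, `h = (b - a) / N`. Markov bounds the norm of this sum by `(exp (8 *
n ^ 2 / N) - 1) * ‖P‖` (`normOf_oscMajorant_le`). The condition on `N` keeps the factor below a
constant less than `1`, so the error is absorbed.

All functions involved are essentially bounded, hence in `X` (`mk_mem_of_memLp_top`). -/

/-! ### Bounded functions belong to every lattice -/

/-- A bounded strongly measurable function is uniformly approximated by simple functions. -/
theorem exists_simpleFunc_norm_sub_le {Ω : Type*} [MeasurableSpace Ω] {f : Ω → ℂ}
    (hf : StronglyMeasurable f) {C : ℝ} (hC : ∀ x, ‖f x‖ ≤ C) {δ : ℝ} (hδ : 0 < δ) :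
    ∃ s : SimpleFunc Ω ℂ, ∀ x, ‖s x - f x‖ ≤ δ := by
  let e := TopologicalSpace.denseSeq ℂ
  obtain ⟨t, ht⟩ := (isCompact_closedBall (0 : ℂ) C).elim_finite_subcover
    (fun k => Metric.ball (e k) δ) (fun _ => Metric.isOpen_ball) (by
      intro z _
      obtain ⟨k, hk⟩ := (TopologicalSpace.denseRange_denseSeq ℂ).exists_dist_lt z hδ
      exact mem_iUnion.2 ⟨k, hk⟩)
  refine ⟨(SimpleFunc.nearestPt e (t.sup id)).comp f hf.measurable, fun x => ?_⟩
  have hx : f x ∈ Metric.closedBall (0 : ℂ) C := by simpa using hC x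
  obtain ⟨k, hk, hxk⟩ := mem_iUnion₂.1 (ht hx)
  have h := SimpleFunc.edist_nearestPt_le e (f x) (Finset.le_sup (f := id) hk)
  rw [edist_dist, edist_dist, ENNReal.ofReal_le_ofReal_iff dist_nonneg] at h
  rw [SimpleFunc.coe_comp, Function.comp_apply, ← dist_eq_norm]
  refine h.trans ?_
  rw [dist_comm]
  exact (Metric.mem_ball.1 hxk).le

namespace BanachFunctionLattice

variable {Ω : Type*} [MeasurableSpace Ω] {μ : Measure Ω} (X : BanachFunctionLattice μ)

theorem nrm_zero : X.nrm 0 = 0 := (X.nrm_eq_zero_iff 0 X.carrier.zero_mem).2 rfl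

theorem nrm_nonneg {f : Ω →ₘ[μ] ℂ} (hf : f ∈ X.carrier) : 0 ≤ X.nrm f := by
  rw [← X.nrm_zero]
  refine X.nrm_mono 0 X.carrier.zero_mem f hf ?_
  filter_upwards [AEEqFun.coeFn_zero (α := Ω) (μ := μ) (β := ℂ)] with x hx
  simp [hx]

theorem simpleFunc_mem [IsFiniteMeasure μ] (s : SimpleFunc Ω ℂ) :
    AEEqFun.mk s s.aestronglyMeasurable ∈ X.carrier := by
  induction s using SimpleFunc.induction with
  | @const c s hs =>
    convert! X.carrier.smul_mem c (X.indicator_mem s hs (measure_lt_top μ s)) using 1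
    rw [AEEqFun.smul_mk, AEEqFun.mk_eq_mk]
    refine Filter.Eventually.of_forall fun x => ?_
    by_cases hx : x ∈ s <;> simp [hx]
  | @add f g _ hf hg =>
    convert! X.carrier.add_mem hf hg using 1

/-- If elements of `X` converge in norm to `g` and uniformly to `f`, then `f = g`. -/
theorem ae_eq_of_tendsto [IsFiniteMeasure μ] {u : ℕ → Ω →ₘ[μ] ℂ} {f : Ω → ℂ} {g : Ω →ₘ[μ] ℂ}
    (hf : StronglyMeasurable f) (hu : ∀ i, u i ∈ X.carrier) (hg : g ∈ X.carrier)
    (hug : ∀ δ : ℝ, 0 < δ → ∃ K : ℕ, ∀ i ≥ K, X.nrm (u i - g) < δ)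
    (huf : ∀ δ : ℝ, 0 < δ → ∃ K : ℕ, ∀ i ≥ K, ∀ᵐ x ∂μ, ‖u i x - f x‖ ≤ δ) :
    f =ᵐ[μ] g := by
  -- On `E = {2δ < |f - g|}` eventually `|u i - g| ≥ δ`, so `δ‖χ_E‖ ≤ ‖u i - g‖ → 0` and `E` is
  -- null.
  have key : ∀ δ : ℝ, 0 < δ → ∀ᵐ x ∂μ, ‖f x - g x‖ ≤ 2 * δ := by
    intro δ hδ
    have hE : MeasurableSet {x | 2 * δ < ‖f x - g x‖} :=
      measurableSet_lt measurable_const (hf.sub g.stronglyMeasurable).norm.measurable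
    have hmem := X.indicator_mem _ hE (measure_lt_top μ _)
    set e := AEEqFun.mk (μ := μ) ({x | 2 * δ < ‖f x - g x‖}.indicator fun _ => (1 : ℂ))
      (stronglyMeasurable_const.indicator hE).aestronglyMeasurable with he
    have hecoe := AEEqFun.coeFn_mk (μ := μ)
      ({x | 2 * δ < ‖f x - g x‖}.indicator fun _ => (1 : ℂ))
      (stronglyMeasurable_const.indicator hE).aestronglyMeasurable
    obtain ⟨K, hK⟩ := huf δ hδ
    have hle : ∀ i ≥ K, δ * X.nrm e ≤ X.nrm (u i - g) := by
      intro i hi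
      have h1 : X.nrm ((δ : ℂ) • e) = δ * X.nrm e := by
        rw [X.nrm_smul _ _ hmem, Complex.norm_real, Real.norm_of_nonneg hδ.le]
      rw [← h1]
      refine X.nrm_mono _ (X.carrier.smul_mem _ hmem) _ (X.carrier.sub_mem (hu i) hg) ?_
      filter_upwards [hK i hi, hecoe, AEEqFun.coeFn_smul (δ : ℂ) e, AEEqFun.coeFn_sub (u i) g]
        with x hx hex hsx hux
      rw [hsx, hux, Pi.smul_apply, Pi.sub_apply, hex]
      by_cases hxE : 2 * δ < ‖f x - g x‖
      · have h2 : ‖f x - g x‖ ≤ ‖u i x - f x‖ + ‖u i x - g x‖ := by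
          rw [norm_sub_rev (u i x) (f x)]
          exact norm_sub_le_norm_sub_add_norm_sub _ _ _
        have h3 : δ ≤ ‖u i x - g x‖ := by linarith
        simpa [indicator, hxE, abs_of_pos hδ] using h3
      · simp [indicator, hxE]
    have h0 : X.nrm e = 0 := by
      refine le_antisymm (le_of_forall_pos_le_add fun η hη => ?_) (X.nrm_nonneg hmem)
      obtain ⟨K', hK'⟩ := hug (δ * η) (mul_pos hδ hη)
      have h4 := (hle (max K K') (le_max_left _ _)).trans_lt (hK' _ (le_max_right _ _))
      linarith [lt_of_mul_lt_mul_left h4 hδ.le]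
    have h1 := (X.nrm_eq_zero_iff e hmem).1 h0
    have h2 := AEEqFun.coeFn_zero (α := Ω) (μ := μ) (β := ℂ)
    rw [← h1] at h2
    filter_upwards [h2, hecoe] with x hx hex
    rw [hex] at hx
    by_contra! hxE
    simp [indicator, hxE] at hx
  have hall : ∀ᵐ x ∂μ, ∀ m : ℕ, ‖f x - g x‖ ≤ 2 * (1 / ((m : ℝ) + 1)) :=
    ae_all_iff.2 fun m => key _ (by positivity)
  filter_upwards [hall] with x hx
  rw [← sub_eq_zero, ← norm_le_zero_iff]
  refine ge_of_tendsto' (x := Filter.atTop) ?_ hx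
  simpa using tendsto_one_div_add_atTop_nhds_zero_nat (𝕜 := ℝ).const_mul (2 : ℝ)

/-- Uniformly approximating simple functions are Cauchy in `X`, since their differences are
dominated by small constants; completeness gives a limit, which must be `f`. -/
theorem mk_mem_of_forall_norm_le [IsFiniteMeasure μ] {f : Ω → ℂ} (hf : StronglyMeasurable f) {C : ℝ}
    (hC : ∀ x, ‖f x‖ ≤ C) : AEEqFun.mk f hf.aestronglyMeasurable ∈ X.carrier := by
  choose s hs using fun i : ℕ =>
    exists_simpleFunc_norm_sub_le hf hC (Nat.one_div_pos_of_nat (α := ℝ) (n := i))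
  have hmem := fun i => X.simpleFunc_mem (s i)
  have hone := X.simpleFunc_mem (SimpleFunc.const Ω (1 : ℂ))
  have hsmall : ∀ δ : ℝ, 0 < δ → ∃ K : ℕ, ∀ i ≥ K, 1 / ((i : ℝ) + 1) < δ := by
    intro δ hδ
    obtain ⟨K, hK⟩ := exists_nat_one_div_lt hδ
    exact ⟨K, fun i hi => (Nat.one_div_le_one_div hi).trans_lt hK⟩
  obtain ⟨g, hg, hlim⟩ := X.complete (fun i => AEEqFun.mk (s i) (s i).aestronglyMeasurable) hmem (by
    intro δ hδ
    set M := X.nrm (AEEqFun.mk (SimpleFunc.const Ω (1 : ℂ)) (SimpleFunc.aestronglyMeasurable _))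
      with hM
    have hM0 : 0 ≤ M := X.nrm_nonneg hone
    -- `M + 1` rather than `M`, because the norm `M` of the constant `1` may vanish.
    obtain ⟨K, hK⟩ := hsmall (δ / (2 * (M + 1))) (by positivity)
    refine ⟨K, fun i hi j hj => ?_⟩
    have hη : 0 < δ / (M + 1) := by positivity
    have h1 : X.nrm (((δ / (M + 1) : ℝ) : ℂ) •
        AEEqFun.mk (SimpleFunc.const Ω (1 : ℂ)) (SimpleFunc.aestronglyMeasurable _))
        = δ / (M + 1) * M := by
      rw [X.nrm_smul _ _ hone, Complex.norm_real, Real.norm_of_nonneg hη.le]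
    have h2 : δ / (M + 1) * M < δ := by
      rw [div_mul_eq_mul_div, div_lt_iff₀ (by positivity)]
      linarith
    refine lt_of_le_of_lt ?_ h2
    rw [← h1]
    refine X.nrm_mono _ (X.carrier.sub_mem (hmem i) (hmem j)) _ (X.carrier.smul_mem _ hone) ?_
    filter_upwards [AEEqFun.coeFn_mk (μ := μ) (s i) (s i).aestronglyMeasurable,
      AEEqFun.coeFn_mk (μ := μ) (s j) (s j).aestronglyMeasurable,
      AEEqFun.coeFn_mk (μ := μ) (SimpleFunc.const Ω (1 : ℂ)) (SimpleFunc.aestronglyMeasurable _),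
      AEEqFun.coeFn_sub (AEEqFun.mk (μ := μ) (s i) (s i).aestronglyMeasurable)
        (AEEqFun.mk (s j) (s j).aestronglyMeasurable),
      AEEqFun.coeFn_smul ((δ / (M + 1) : ℝ) : ℂ) (AEEqFun.mk (μ := μ)
        (SimpleFunc.const Ω (1 : ℂ)) (SimpleFunc.aestronglyMeasurable _))] with x hi' hj' ho hd hc
    rw [hd, hc, Pi.sub_apply, Pi.smul_apply, hi', hj', ho]
    have h3 : ‖s i x - s j x‖ ≤ ‖s i x - f x‖ + ‖s j x - f x‖ := by
      rw [norm_sub_rev (s j x)]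
      exact norm_sub_le_norm_sub_add_norm_sub _ _ _
    have h4 : δ / (2 * (M + 1)) = δ / (M + 1) / 2 := by field_simp
    have h5 : ‖s i x - s j x‖ ≤ δ / (M + 1) := by
      linarith [hs i x, hs j x, hK i hi, hK j hj]
    have h6 : ‖((δ / (M + 1) : ℝ) : ℂ)‖ = δ / (M + 1) := by
      rw [Complex.norm_real, Real.norm_of_nonneg hη.le]
    rw [SimpleFunc.coe_const, Function.const_apply, smul_eq_mul, mul_one, h6]
    exact h5)
  have hfg := X.ae_eq_of_tendsto hf hmem hg hlim (by
    intro δ hδ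
    obtain ⟨K, hK⟩ := hsmall δ hδ
    refine ⟨K, fun i hi => ?_⟩
    filter_upwards [AEEqFun.coeFn_mk (μ := μ) (s i) (s i).aestronglyMeasurable] with x hx
    rw [hx]
    exact (hs i x).trans (hK i hi).le)
  have : AEEqFun.mk f hf.aestronglyMeasurable = g := by
    rw [← AEEqFun.mk_coeFn g, AEEqFun.mk_eq_mk]
    exact hfg
  rwa [this]

/-- A lattice on a finite measure space contains every essentially bounded function. -/
theorem mk_mem_of_memLp_top [IsFiniteMeasure μ] {f : Ω → ℂ} (hf : MemLp f ⊤ μ) :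
    AEEqFun.mk f hf.aestronglyMeasurable ∈ X.carrier := by
  obtain ⟨g, hg, hfg⟩ : ∃ g, StronglyMeasurable g ∧ f =ᵐ[μ] g := hf.aestronglyMeasurable
  have hb : ∀ᵐ x ∂μ, ‖g x‖ ≤ lpNorm f ⊤ μ := by
    filter_upwards [hfg, ae_le_lpNorm_exponent_top hf] with x hx hx'
    rwa [← hx]
  set C := lpNorm f ⊤ μ
  have hE : MeasurableSet {x | ‖g x‖ ≤ C} := measurableSet_le hg.norm.measurable measurable_const
  have hC0 : 0 ≤ C := lpNorm_nonneg
  have hfe : AEEqFun.mk f hf.aestronglyMeasurable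
      = AEEqFun.mk _ (hg.indicator hE).aestronglyMeasurable := by
    rw [AEEqFun.mk_eq_mk]
    filter_upwards [hfg, hb] with x hx hx'
    simp [indicator, hx', hx]
  rw [hfe]
  exact X.mk_mem_of_forall_norm_le (hg.indicator hE) (C := C) fun x => by
    by_cases hx : ‖g x‖ ≤ C <;> simp [indicator, hx, hC0]

end BanachFunctionLattice

/-! ### The norm on essentially bounded functions -/

namespace BanachFunctionLattice

variable {Ω : Type*} [MeasurableSpace Ω] {μ : Measure Ω} (X : BanachFunctionLattice μ)

open Classical in
/-- The norm in `X` of the class of a function (of the zero function if it is not measurable). -/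
noncomputable def normOf (f : Ω → ℂ) : ℝ :=
  X.nrm (if hf : AEStronglyMeasurable f μ then AEEqFun.mk f hf else 0)

variable {X} in
theorem normOf_eq {f : Ω → ℂ} (hf : AEStronglyMeasurable f μ) :
    X.normOf f = X.nrm (AEEqFun.mk f hf) := by
  rw [normOf, dif_pos hf]

theorem normOf_zero : X.normOf (fun _ => 0) = 0 := by
  rw [normOf_eq aestronglyMeasurable_const]
  exact X.nrm_zero

variable [IsFiniteMeasure μ] {f g : Ω → ℂ}

theorem normOf_nonneg (hf : MemLp f ⊤ μ) : 0 ≤ X.normOf f := by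
  rw [normOf_eq hf.1]
  exact X.nrm_nonneg (X.mk_mem_of_memLp_top hf)

theorem normOf_mono (hf : MemLp f ⊤ μ) (hg : MemLp g ⊤ μ) (h : ∀ᵐ x ∂μ, ‖f x‖ ≤ ‖g x‖) :
    X.normOf f ≤ X.normOf g := by
  rw [normOf_eq hf.1, normOf_eq hg.1]
  refine X.nrm_mono _ (X.mk_mem_of_memLp_top hf) _ (X.mk_mem_of_memLp_top hg) ?_
  filter_upwards [h, AEEqFun.coeFn_mk f hf.1, AEEqFun.coeFn_mk g hg.1] with x hx hfx hgx
  rwa [hfx, hgx]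

theorem normOf_congr (hf : MemLp f ⊤ μ) (hg : MemLp g ⊤ μ) (h : ∀ᵐ x ∂μ, ‖f x‖ = ‖g x‖) :
    X.normOf f = X.normOf g :=
  le_antisymm (X.normOf_mono hf hg (h.mono fun _ => le_of_eq))
    (X.normOf_mono hg hf (h.mono fun _ => ge_of_eq))

theorem normOf_add_le (hf : MemLp f ⊤ μ) (hg : MemLp g ⊤ μ) :
    X.normOf (fun x => f x + g x) ≤ X.normOf f + X.normOf g := by
  rw [normOf_eq hf.1, normOf_eq hg.1, normOf_eq (f := fun x => f x + g x) (hf.1.add hg.1)]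
  exact X.nrm_add_le _ (X.mk_mem_of_memLp_top hf) _ (X.mk_mem_of_memLp_top hg)

theorem normOf_const_mul (c : ℂ) (hf : MemLp f ⊤ μ) :
    X.normOf (fun x => c * f x) = ‖c‖ * X.normOf f := by
  rw [normOf_eq hf.1, normOf_eq (f := fun x => c * f x) (hf.1.const_smul c)]
  exact X.nrm_smul c _ (X.mk_mem_of_memLp_top hf)

theorem normOf_norm (hf : MemLp f ⊤ μ) : X.normOf (fun x => ((‖f x‖ : ℝ) : ℂ)) = X.normOf f :=
  X.normOf_congr hf.norm.ofReal hf (Filter.Eventually.of_forall fun x => by simp)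

theorem normOf_le_add {h : Ω → ℂ} (hh : MemLp h ⊤ μ) (hf : MemLp f ⊤ μ) (hg : MemLp g ⊤ μ)
    (hle : ∀ᵐ x ∂μ, ‖h x‖ ≤ ‖f x‖ + ‖g x‖) : X.normOf h ≤ X.normOf f + X.normOf g := by
  have hf' : MemLp (fun x => ((‖f x‖ : ℝ) : ℂ)) ⊤ μ := hf.norm.ofReal
  have hg' : MemLp (fun x => ((‖g x‖ : ℝ) : ℂ)) ⊤ μ := hg.norm.ofReal
  rw [← X.normOf_norm hf, ← X.normOf_norm hg]
  refine le_trans (X.normOf_mono hh (hf'.add hg') ?_) (X.normOf_add_le hf' hg')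
  filter_upwards [hle] with x hx
  rwa [Pi.add_apply, ← Complex.ofReal_add, Complex.norm_real, Real.norm_of_nonneg (by positivity)]

theorem normOf_sum_le {ι : Type*} (s : Finset ι) {F : ι → Ω → ℂ} (hF : ∀ i ∈ s, MemLp (F i) ⊤ μ) :
    X.normOf (fun x => ∑ i ∈ s, F i x) ≤ ∑ i ∈ s, X.normOf (F i) := by
  classical
  induction s using Finset.induction_on with
  | empty => simp [X.normOf_zero]
  | insert i s hi ih =>
    simp only [Finset.sum_insert hi]
    have hs : ∀ j ∈ s, MemLp (F j) ⊤ μ := fun j hj => hF j (Finset.mem_insert_of_mem hj)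
    exact (X.normOf_add_le (hF i (Finset.mem_insert_self i s)) (memLp_finsetSum s hs)).trans
      (by grw [ih hs])

/-- Levels `y ≤ 0` carry no information. Restricting to `y > 0` lets indicator cut-offs be compared
on their supports alone. -/
theorem RearrangementInvariant.normOf_eq_normOf {X : BanachFunctionLattice μ}
    (hX : X.RearrangementInvariant) (hf : MemLp f ⊤ μ) (hg : MemLp g ⊤ μ)
    (h : ∀ y : ℝ, 0 < y → μ {x | y ≤ ‖f x‖} = μ {x | y ≤ ‖g x‖}) : X.normOf f = X.normOf g := by
  rw [normOf_eq hf.1, normOf_eq hg.1]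
  refine hX _ (X.mk_mem_of_memLp_top hf) _ (X.mk_mem_of_memLp_top hg) fun y => ?_
  rcases le_or_gt y 0 with hy | hy
  · congr 1
    ext x
    exact ⟨fun _ => hy.trans (norm_nonneg _), fun _ => hy.trans (norm_nonneg _)⟩
  have key : ∀ {k : Ω → ℂ} (hk : AEStronglyMeasurable k μ),
      μ {x | y ≤ ‖AEEqFun.mk k hk x‖} = μ {x | y ≤ ‖k x‖} := by
    intro k hk
    refine measure_congr ?_
    filter_upwards [AEEqFun.coeFn_mk k hk] with x hx
    apply propext
    change y ≤ ‖AEEqFun.mk k hk x‖ ↔ y ≤ ‖k x‖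
    rw [hx]
  rw [key, key, h y hy]

end BanachFunctionLattice

/-! ### Translates in a rearrangement invariant lattice -/

/-- In a rearrangement invariant lattice, cutting off a translate to an interval whose translate
stays in `[a, b]` does not increase the norm. -/
theorem normOf_indicator_translate_le {a b : ℝ} {X : BanachFunctionLattice (lebIcc a b)}
    (hX : X.RearrangementInvariant) {f : ℝ → ℂ} {u v s : ℝ}
    (hau : a ≤ u) (hvb : v ≤ b) (hau' : a ≤ u + s) (hvb' : v + s ≤ b)
    (h₁ : MemLp ((Icc u v).indicator fun x => f (x + s)) ⊤ (lebIcc a b))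
    (h₂ : MemLp f ⊤ (lebIcc a b)) :
    X.normOf ((Icc u v).indicator fun x => f (x + s)) ≤ X.normOf f := by
  have h₃ : MemLp ((Icc (u + s) (v + s)).indicator f) ⊤ (lebIcc a b) :=
    h₂.indicator measurableSet_Icc
  have hle : X.normOf ((Icc (u + s) (v + s)).indicator f) ≤ X.normOf f :=
    X.normOf_mono h₃ h₂ (Filter.Eventually.of_forall fun x => norm_indicator_le_norm_self _ _)
  refine le_of_eq_of_le (hX.normOf_eq_normOf h₁ h₃ fun y hy => ?_) hle
  have hind : ∀ (S : Set ℝ) (k : ℝ → ℂ), {x | y ≤ ‖S.indicator k x‖} = S ∩ {x | y ≤ ‖k x‖} := by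
    intro S k
    ext x
    change y ≤ ‖S.indicator k x‖ ↔ x ∈ S ∧ y ≤ ‖k x‖
    by_cases hx : x ∈ S <;> simp [hx, hy]
  have hpre : Icc u v ∩ {x | y ≤ ‖f (x + s)‖}
      = (fun x => x + s) ⁻¹' (Icc (u + s) (v + s) ∩ {x | y ≤ ‖f x‖}) := by
    rw [preimage_inter, preimage_add_const_Icc, add_sub_cancel_right, add_sub_cancel_right]
    rfl
  have hsub₁ : Icc u v ∩ {x | y ≤ ‖f (x + s)‖} ⊆ Icc a b :=
    inter_subset_left.trans (Icc_subset_Icc hau hvb)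
  have hsub₂ : Icc (u + s) (v + s) ∩ {x | y ≤ ‖f x‖} ⊆ Icc a b :=
    inter_subset_left.trans (Icc_subset_Icc hau' hvb')
  rw [hind, hind, Measure.restrict_eq_self _ hsub₁, Measure.restrict_eq_self _ hsub₂, hpre]
  exact measure_preimage_add_right _ _ _

theorem memLp_top_of_continuous {a b : ℝ} {f : ℝ → ℂ} (hf : Continuous f) :
    MemLp f ⊤ (lebIcc a b) := by
  obtain ⟨C, hC⟩ := isCompact_Icc.exists_bound_of_continuousOn (s := Icc a b) hf.continuousOn
  exact memLp_top_of_bound hf.aestronglyMeasurable C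
    (ae_restrict_of_forall_mem measurableSet_Icc hC)

theorem continuous_eval_ofReal (P : Polynomial ℂ) : Continuous fun x : ℝ => P.eval (x : ℂ) :=
  P.continuous.comp Complex.continuous_ofReal

/-! ### Derivatives through Chebyshev interpolation -/

open Polynomial Polynomial.Chebyshev in
/-- Lagrange interpolation at the extremal points of the Chebyshev polynomial expresses the
derivative at the endpoint through values with coefficients of total size `n ^ 2`. -/
theorem exists_eval_one_derivative_eq_sum {n : ℕ} (hn : 1 ≤ n) :
    ∃ c : ℕ → ℝ, ∑ i ∈ Finset.range (n + 1), |c i| = (n : ℝ) ^ 2 ∧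
      ∀ P : ℂ[X], P.natDegree ≤ n →
        P.derivative.eval 1 = ∑ i ∈ Finset.range (n + 1), (c i : ℂ) * P.eval (node n i : ℂ) := by
  -- The derivative at `1` of the `i`-th Lagrange basis polynomial.
  let c : ℕ → ℝ := fun i =>
    (∏ j ∈ (Finset.range (n + 1)).erase i, (node n i - node n j))⁻¹ *
      ∑ t ∈ ((Finset.range (n + 1)).erase i).powersetCard (n - 1), ∏ a ∈ t, (1 - node n a)
  have hinj : InjOn (fun i => (node n i : ℂ)) (Finset.range (n + 1)) :=
    Complex.ofReal_injective.comp_injOn (strictAntiOn_node n).injOn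
  have hc : ∀ P : ℂ[X], P.natDegree ≤ n →
      P.derivative.eval 1 = ∑ i ∈ Finset.range (n + 1), (c i : ℂ) * P.eval (node n i : ℂ) := by
    intro P hP
    have hdeg : P.degree < (Finset.range (n + 1)).card := by
      rw [Finset.card_range]
      exact (degree_le_natDegree.trans (Nat.cast_le.2 hP)).trans_lt (Nat.cast_lt.2 n.lt_succ_self)
    have := Lagrange.eval_iterate_derivative_eq_sum hinj hdeg (k := 1) (by simp; omega) 1
    rw [Function.iterate_one] at this
    rw [this]
    simp only [c, Nat.factorial_one, Nat.cast_one, one_mul, Finset.card_range]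
    refine Finset.sum_congr rfl fun i _ => ?_
    push_cast
    ring
  -- The signs alternate: the nodes decrease, which fixes the sign of the denominator, and none
  -- exceeds `1`, so the sum of products is nonnegative.
  have hpos : ∀ i ∈ Finset.range (n + 1), |c i| = c i * (-1) ^ i := by
    intro i hi
    have h1 : 0 ≤ (-1) ^ i * c i := by
      have := (inv_pos_of_pos (zero_lt_prod_node_sub_node (Finset.mem_range_succ_iff.1 hi))).le
      rw [mul_inv, ← inv_pow, inv_neg_one] at this
      rw [← mul_assoc]
      exact mul_nonneg this (Finset.sum_nonneg fun t _ => Finset.prod_nonneg fun a _ =>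
        sub_nonneg.2 node_mem_Icc.2)
    calc |c i| = |(-1) ^ i * c i| := by rw [abs_mul ((-1) ^ i) (c i), abs_neg_one_pow, one_mul]
      _ = c i * (-1) ^ i := by rw [abs_of_nonneg h1, mul_comm]
  refine ⟨c, ?_, hc⟩
  -- `T n` takes the value `(-1) ^ i` at the nodes, so it is extremal: the sum of `|c i|` equals `T
  -- n' (1) = n ^ 2`.
  have hT := hc (T ℂ n) (by rw [natDegree_T]; simp)
  rw [T_derivative_eq_U] at hT
  have hT' : ((∑ i ∈ Finset.range (n + 1), |c i| : ℝ) : ℂ) = ((n : ℝ) ^ 2 : ℝ) := by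
    rw [Finset.sum_congr rfl hpos]
    push_cast
    have h2 : ∀ i ∈ Finset.range (n + 1), (T ℂ n).eval (node n i : ℂ) = (-1) ^ i := by
      intro i hi
      rw [← complex_ofReal_eval_T,
        eval_T_real_node (Finset.mem_Iic.2 (Finset.mem_range_succ_iff.1 hi))]
      push_cast
      rfl
    rw [Finset.sum_congr rfl fun i hi => by rw [h2 i hi]] at hT
    rw [← hT]
    simp
    ring
  exact_mod_cast hT'

open Polynomial Polynomial.Chebyshev in
/-- The derivative of a polynomial of degree at most `n` is a combination of its translates. -/
theorem exists_mul_eval_derivative_eq_sum (n : ℕ) :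
    ∃ t c : ℕ → ℝ, (∀ i, t i ∈ Icc (0 : ℝ) 1) ∧
      ∑ i ∈ Finset.range (n + 1), |c i| ≤ 2 * (n : ℝ) ^ 2 ∧
      ∀ P : ℂ[X], P.natDegree ≤ n → ∀ x h : ℂ,
        h * P.derivative.eval x = ∑ i ∈ Finset.range (n + 1), (c i : ℂ) * P.eval (x + h * t i) := by
  rcases Nat.eq_zero_or_pos n with rfl | hn
  · refine ⟨0, 0, by simp, by simp, fun P hP x h => ?_⟩
    rw [eq_C_of_natDegree_le_zero hP]
    simp
  obtain ⟨c, hcs, hc⟩ := exists_eval_one_derivative_eq_sum hn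
  refine ⟨fun i => (1 - node n i) / 2, fun i => -2 * c i, fun i => ?_, ?_, fun P hP x h => ?_⟩
  · have := node_mem_Icc (n := n) (i := i)
    constructor <;> linarith [this.1, this.2]
  · simp_rw [abs_mul, abs_neg, abs_two, ← Finset.mul_sum, hcs, le_refl]
  -- The map `y ↦ x + h / 2 - (h / 2) * y` sends `1` to `x` and `-1` to `x + h`; its slope `-h / 2`
  -- accounts for the factor `-2`.
  have hQ := hc (P.comp (C (x + h / 2) - C (h / 2) * X)) (by
    refine natDegree_comp_le.trans ?_
    have : (C (x + h / 2) - C (h / 2) * X : ℂ[X]).natDegree ≤ 1 := by compute_degree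
    exact (Nat.mul_le_mul hP this).trans (by simp))
  simp only [derivative_comp, eval_mul, eval_comp, eval_sub, eval_C, eval_X, derivative_sub,
    derivative_C, derivative_mul, derivative_X] at hQ
  have h1 : h * P.derivative.eval x = -2 * ((0 - (0 * 1 + h / 2 * eval 1 1)) *
      P.derivative.eval (x + h / 2 - h / 2 * 1)) := by
    rw [eval_one, show x + h / 2 - h / 2 * 1 = x by ring]
    ring
  rw [h1]
  simp only [eval_add, eval_mul, eval_zero, eval_one, eval_C, eval_X] at hQ ⊢
  rw [hQ, Finset.mul_sum]
  refine Finset.sum_congr rfl fun i _ => ?_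
  push_cast
  rw [show x + h / 2 - h / 2 * (node n i : ℂ) = x + h * ((1 - node n i) / 2) by ring]
  ring

theorem memLp_top_eval (a b : ℝ) (P : Polynomial ℂ) :
    MemLp (fun x : ℝ => P.eval (x : ℂ)) ⊤ (lebIcc a b) :=
  memLp_top_of_continuous (continuous_eval_ofReal P)

theorem polyFun_mem {a b : ℝ} (X : BanachFunctionLattice (lebIcc a b)) (P : Polynomial ℂ) :
    polyFun a b P ∈ X.carrier :=
  X.mk_mem_of_memLp_top (memLp_top_eval a b P)

theorem nrm_polyFun {a b : ℝ} (X : BanachFunctionLattice (lebIcc a b)) (P : Polynomial ℂ) :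
    X.nrm (polyFun a b P) = X.normOf fun x : ℝ => P.eval (x : ℂ) :=
  (BanachFunctionLattice.normOf_eq _).symm

/-! ### Markov inequality -/

section Markov

variable {a b : ℝ} {X : BanachFunctionLattice (lebIcc a b)}

/-- Each shift `h * t i` lies between `0` and `h`, so `[u, v]` shifted by it stays in `[a, b]`, and
every cut-off translate of `P` has norm at most that of `P`. -/
theorem abs_mul_normOf_indicator_derivative_le (hX : X.RearrangementInvariant) {n : ℕ}
    {P : Polynomial ℂ} (hP : P.natDegree ≤ n) {u v h : ℝ} (hau : a ≤ u) (hvb : v ≤ b)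
    (hau' : a ≤ u + h) (hvb' : v + h ≤ b) :
    |h| * X.normOf ((Icc u v).indicator fun x : ℝ => P.derivative.eval (x : ℂ)) ≤
      2 * (n : ℝ) ^ 2 * X.normOf fun x : ℝ => P.eval (x : ℂ) := by
  obtain ⟨t, c, ht, hc, hsum⟩ := exists_mul_eval_derivative_eq_sum n
  have hmem : ∀ i, MemLp ((Icc u v).indicator fun x : ℝ => P.eval ((x + h * t i : ℝ) : ℂ)) ⊤
      (lebIcc a b) := fun i =>
    (memLp_top_of_continuous ((continuous_eval_ofReal P).comp (continuous_add_const _))).indicator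
      measurableSet_Icc
  have hfun : (fun x => (h : ℂ) * (Icc u v).indicator (fun x : ℝ => P.derivative.eval (x : ℂ)) x)
      = fun x => ∑ i ∈ Finset.range (n + 1),
        (c i : ℂ) * (Icc u v).indicator (fun x : ℝ => P.eval ((x + h * t i : ℝ) : ℂ)) x := by
    funext x
    by_cases hx : x ∈ Icc u v
    · simp only [indicator_of_mem hx, hsum P hP]
      push_cast
      rfl
    · simp [indicator_of_notMem hx]
  have hnorm := X.normOf_const_mul (h : ℂ)
    ((memLp_top_eval a b P.derivative).indicator (measurableSet_Icc (a := u) (b := v)))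
  rw [Complex.norm_real, Real.norm_eq_abs] at hnorm
  rw [← hnorm, hfun]
  refine (X.normOf_sum_le _ fun i _ => (hmem i).const_mul _).trans ?_
  calc _ ≤ ∑ i ∈ Finset.range (n + 1), |c i| * X.normOf fun x : ℝ => P.eval (x : ℂ) := by
        refine Finset.sum_le_sum fun i _ => ?_
        rw [X.normOf_const_mul _ (hmem i), Complex.norm_real, Real.norm_eq_abs]
        refine mul_le_mul_of_nonneg_left ?_ (abs_nonneg _)
        have h0 := (ht i).1
        have h1 := sub_nonneg.2 (ht i).2
        exact normOf_indicator_translate_le (f := fun x : ℝ => P.eval (x : ℂ)) hX hau hvb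
          (by nlinarith) (by nlinarith) (hmem i) (memLp_top_eval a b P)
    _ ≤ _ := by
        rw [← Finset.sum_mul]
        exact mul_le_mul_of_nonneg_right hc (X.normOf_nonneg (memLp_top_eval a b P))

theorem normOf_derivative_le (hab : a < b) (hX : X.RearrangementInvariant) {n : ℕ}
    {P : Polynomial ℂ} (hP : P.natDegree ≤ n) :
    X.normOf (fun x : ℝ => P.derivative.eval (x : ℂ)) ≤
      8 * (n : ℝ) ^ 2 / (b - a) * X.normOf fun x : ℝ => P.eval (x : ℂ) := by
  have hba : 0 < b - a := sub_pos.2 hab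
  have hl := abs_mul_normOf_indicator_derivative_le hX hP (u := a) (v := (a + b) / 2)
    (h := (b - a) / 2) le_rfl (by linarith) (by linarith) (by linarith)
  have hr := abs_mul_normOf_indicator_derivative_le hX hP (u := (a + b) / 2) (v := b)
    (h := -((b - a) / 2)) (by linarith) le_rfl (by linarith) (by linarith)
  rw [abs_neg] at hr
  rw [abs_of_pos (half_pos hba)] at hl hr
  have hD := memLp_top_eval a b P.derivative
  have hDl := hD.indicator (measurableSet_Icc (a := a) (b := (a + b) / 2))
  have hDr := hD.indicator (measurableSet_Icc (a := (a + b) / 2) (b := b))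
  have hsplit : X.normOf (fun x : ℝ => P.derivative.eval (x : ℂ)) ≤
      X.normOf ((Icc a ((a + b) / 2)).indicator fun x : ℝ => P.derivative.eval (x : ℂ)) +
      X.normOf ((Icc ((a + b) / 2) b).indicator fun x : ℝ => P.derivative.eval (x : ℂ)) := by
    refine X.normOf_le_add hD hDl hDr (ae_restrict_of_forall_mem measurableSet_Icc fun x hx => ?_)
    rcases le_total x ((a + b) / 2) with h | h
    · rw [indicator_of_mem (show x ∈ Icc a ((a + b) / 2) from ⟨hx.1, h⟩)]
      exact le_add_of_nonneg_right (norm_nonneg _)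
    · rw [indicator_of_mem (show x ∈ Icc ((a + b) / 2) b from ⟨h, hx.2⟩)]
      exact le_add_of_nonneg_left (norm_nonneg _)
  rw [div_mul_eq_mul_div, le_div_iff₀ hba]
  nlinarith

theorem normOf_iterate_derivative_le (hab : a < b) (hX : X.RearrangementInvariant) {n : ℕ} (r : ℕ)
    {P : Polynomial ℂ} (hP : P.natDegree ≤ n) :
    X.normOf (fun x : ℝ => (Polynomial.derivative^[r] P).eval (x : ℂ)) ≤
      (8 * (n : ℝ) ^ 2 / (b - a)) ^ r * X.normOf fun x : ℝ => P.eval (x : ℂ) := by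
  have hba : 0 < b - a := sub_pos.2 hab
  induction r with
  | zero => simp
  | succ r ih =>
    rw [Function.iterate_succ_apply', pow_succ', mul_assoc]
    refine (normOf_derivative_le hab hX (n := n) ?_).trans
      (mul_le_mul_of_nonneg_left ih (by positivity))
    exact (P.natDegree_iterate_derivative r).trans ((Nat.sub_le _ _).trans hP)

end Markov

/-! ### Oscillation of polynomials and the Marcinkiewicz–Zygmund inequality -/

section MarcinkiewiczZygmund

/-- Taylor's formula bounds the oscillation of a polynomial through its derivatives. -/
theorem norm_eval_sub_eval_le {n : ℕ} {P : Polynomial ℂ} (hP : P.natDegree ≤ n) {z w : ℂ} {h : ℝ}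
    (hzw : ‖w - z‖ ≤ h) :
    ‖P.eval w - P.eval z‖ ≤ ∑ r ∈ Finset.range n,
      h ^ (r + 1) / ((r + 1).factorial : ℝ) * ‖(Polynomial.derivative^[r + 1] P).eval z‖ := by
  have htaylor : P.eval w = ∑ r ∈ Finset.range (n + 1),
      (Polynomial.hasseDeriv r P).eval z * (w - z) ^ r := by
    have h1 : (Polynomial.taylor z P).eval (w - z) = P.eval w := by
      rw [Polynomial.taylor_eval, sub_add_cancel]
    rw [← h1, Polynomial.eval_eq_sum_range' (n := n + 1)
      (by rw [Polynomial.natDegree_taylor]; omega)]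
    simp_rw [Polynomial.taylor_coeff]
  rw [htaylor, Finset.sum_range_succ', Polynomial.hasseDeriv_zero', pow_zero, mul_one,
    add_sub_cancel_right]
  refine (norm_sum_le _ _).trans (Finset.sum_le_sum fun r _ => ?_)
  have hfac : (((r + 1).factorial : ℕ) : ℂ) * (Polynomial.hasseDeriv (r + 1) P).eval z
      = (Polynomial.derivative^[r + 1] P).eval z := by
    rw [← Polynomial.factorial_smul_hasseDeriv]
    simp
  have hpos : (0 : ℝ) < ((r + 1).factorial : ℝ) := by positivity
  rw [← hfac, norm_mul, norm_mul, norm_pow, Complex.norm_natCast]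
  calc ‖(Polynomial.hasseDeriv (r + 1) P).eval z‖ * ‖w - z‖ ^ (r + 1)
      ≤ ‖(Polynomial.hasseDeriv (r + 1) P).eval z‖ * h ^ (r + 1) := by gcongr
    _ = _ := by field_simp

/-- Almost every point of `[a, b]` lies in exactly one of the subintervals. -/
theorem ae_existsUnique_mem_subInterval {a b : ℝ} (hab : a < b) {N : ℕ} (hN : 0 < N) :
    ∀ᵐ t ∂(lebIcc a b), ∃ k ∈ Finset.Icc 1 N, t ∈ subInterval a b N k ∧
      ∀ j ∈ Finset.Icc 1 N, j ≠ k → t ∉ subInterval a b N j := by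
  have hba : 0 < b - a := sub_pos.2 hab
  have hN' : (0 : ℝ) < N := Nat.cast_pos.2 hN
  -- Adjacent closed subintervals overlap only at division points, a null set; elsewhere the
  -- rescaled coordinate `τ` is not an integer and its floor determines the subinterval.
  have hcount : ∀ᵐ t ∂(lebIcc a b), t ∉ range fun k : ℕ => a + (b - a) * (k : ℝ) / N :=
    measure_eq_zero_iff_ae_notMem.1 ((countable_range _).measure_zero _)
  filter_upwards [hcount, ae_restrict_mem measurableSet_Icc] with t ht hab'
  set τ := (t - a) * N / (b - a) with hτ
  have htτ : t = a + (b - a) * τ / N := by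
    rw [hτ]
    field_simp
    ring
  have hne : ∀ k : ℕ, τ ≠ k := by
    rintro k hk
    exact ht ⟨k, by rw [htτ, hk]⟩
  have hmem : ∀ j : ℕ, t ∈ subInterval a b N j ↔ (j : ℝ) - 1 ≤ τ ∧ τ ≤ j := by
    intro j
    rw [htτ, subInterval, mem_Icc, add_le_add_iff_left, add_le_add_iff_left,
      div_le_div_iff_of_pos_right hN', div_le_div_iff_of_pos_right hN',
      mul_le_mul_iff_right₀ hba, mul_le_mul_iff_right₀ hba]
  have hτ0 : 0 ≤ τ := div_nonneg (mul_nonneg (sub_nonneg.2 hab'.1) hN'.le) hba.le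
  have hτN : τ < N := by
    refine lt_of_le_of_ne ?_ (hne N)
    rw [hτ, div_le_iff₀ hba, mul_comm]
    exact mul_le_mul_of_nonneg_left (by linarith [hab'.2]) hN'.le
  refine ⟨⌊τ⌋₊ + 1, Finset.mem_Icc.2 ⟨by omega, (Nat.floor_lt hτ0).2 hτN⟩, ?_, ?_⟩
  · rw [hmem]
    push_cast
    exact ⟨by simpa using Nat.floor_le hτ0, (Nat.lt_floor_add_one τ).le⟩
  · intro j hj hjk htj
    have h1 := (Finset.mem_Icc.1 hj).1
    obtain ⟨h2, h3⟩ := (hmem j).1 htj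
    refine hjk ?_
    have : ⌊τ⌋₊ = j - 1 := by
      rw [Nat.floor_eq_iff hτ0]
      push_cast [h1]
      exact ⟨h2, by linarith [lt_of_le_of_ne h3 (hne j)]⟩
    omega

theorem norm_sub_le_of_mem_subInterval {a b : ℝ} {N k : ℕ} {s t : ℝ}
    (hs : s ∈ subInterval a b N k) (ht : t ∈ subInterval a b N k) :
    ‖(s : ℂ) - t‖ ≤ (b - a) / N := by
  rw [← Complex.ofReal_sub, Complex.norm_real, Real.norm_eq_abs]
  refine (abs_sub_le_of_le_of_le hs.1 hs.2 ht.1 ht.2).trans_eq ?_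
  ring

/-- The step function taking the value `|P (x k)|` on the `k`-th subinterval. -/
noncomputable def sampleStep (a b : ℝ) (N : ℕ) (x : ℕ → ℝ) (P : Polynomial ℂ) (t : ℝ) : ℂ :=
  ∑ k ∈ Finset.Icc 1 N,
    (subInterval a b N k).indicator (fun _ => ((‖P.eval (x k : ℂ)‖ : ℝ) : ℂ)) t

theorem memLp_top_sampleStep (a b : ℝ) (N : ℕ) (x : ℕ → ℝ) (P : Polynomial ℂ) :
    MemLp (sampleStep a b N x P) ⊤ (lebIcc a b) :=
  memLp_finsetSum _ fun _ _ => (memLp_const _).indicator measurableSet_Icc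

variable {a b : ℝ} (X : BanachFunctionLattice (lebIcc a b))

theorem sampleFun_mem (N : ℕ) (x : ℕ → ℝ) (P : Polynomial ℂ) :
    sampleFun a b N x P ∈ X.carrier :=
  X.mk_mem_of_memLp_top (memLp_top_sampleStep a b N x P)

theorem nrm_sampleFun (N : ℕ) (x : ℕ → ℝ) (P : Polynomial ℂ) :
    X.nrm (sampleFun a b N x P) = X.normOf (sampleStep a b N x P) :=
  (BanachFunctionLattice.normOf_eq _).symm

/-- The majorant of the oscillation of `P` over intervals of length `h`. -/
noncomputable def oscMajorant (n : ℕ) (P : Polynomial ℂ) (h : ℝ) (t : ℝ) : ℝ :=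
  ∑ r ∈ Finset.range n,
    h ^ (r + 1) / ((r + 1).factorial : ℝ) * ‖(Polynomial.derivative^[r + 1] P).eval (t : ℂ)‖

theorem ae_abs_norm_sampleStep_sub_norm_eval_le (hab : a < b) {n N : ℕ} (hN : 0 < N) {x : ℕ → ℝ}
    (hx : ∀ k ∈ Finset.Icc 1 N, x k ∈ subInterval a b N k) {P : Polynomial ℂ}
    (hP : P.natDegree ≤ n) :
    ∀ᵐ t ∂(lebIcc a b), |‖sampleStep a b N x P t‖ - ‖P.eval (t : ℂ)‖| ≤
      oscMajorant n P ((b - a) / N) t := by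
  filter_upwards [ae_existsUnique_mem_subInterval hab hN] with t ⟨k, hk, htk, huniq⟩
  have hval : sampleStep a b N x P t = ((‖P.eval (x k : ℂ)‖ : ℝ) : ℂ) := by
    rw [sampleStep, Finset.sum_eq_single_of_mem k hk fun j hj hjk =>
      indicator_of_notMem (huniq j hj hjk) _, indicator_of_mem htk]
  rw [hval, Complex.norm_real, norm_norm]
  exact (abs_norm_sub_norm_le _ _).trans
    (norm_eval_sub_eval_le hP (norm_sub_le_of_mem_subInterval (hx k hk) htk))

theorem memLp_top_oscMajorant (n : ℕ) (P : Polynomial ℂ) (h : ℝ) :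
    MemLp (fun t => (oscMajorant n P h t : ℂ)) ⊤ (lebIcc a b) := by
  refine memLp_top_of_continuous (Complex.continuous_ofReal.comp ?_)
  exact continuous_finsetSum _ fun r _ => continuous_const.mul (continuous_eval_ofReal _).norm

variable {X}

/-- With Markov applied to each derivative, the `r`-th term is at most `(8 * n ^ 2 / N) ^ r / r!`
times the norm of `P`: the length `b - a` cancels and a partial exponential series without its
zeroth term remains. -/
theorem normOf_oscMajorant_le (hab : a < b) (hX : X.RearrangementInvariant) {n N : ℕ}
    {P : Polynomial ℂ} (hP : P.natDegree ≤ n) :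
    X.normOf (fun t => (oscMajorant n P ((b - a) / N) t : ℂ)) ≤
      (Real.exp (8 * (n : ℝ) ^ 2 / N) - 1) * X.normOf fun x : ℝ => P.eval (x : ℂ) := by
  have hba : 0 < b - a := sub_pos.2 hab
  have hterm : ∀ r, MemLp (fun t : ℝ =>
      ((‖(Polynomial.derivative^[r + 1] P).eval (t : ℂ)‖ : ℝ) : ℂ)) ⊤ (lebIcc a b) :=
    fun r => (memLp_top_eval a b _).norm.ofReal
  have hP0 := X.normOf_nonneg (memLp_top_eval a b P)
  simp only [oscMajorant, Complex.ofReal_sum, Complex.ofReal_mul]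
  refine (X.normOf_sum_le _ fun r _ => (hterm r).const_mul _).trans ?_
  calc _ ≤ ∑ r ∈ Finset.range n, (8 * (n : ℝ) ^ 2 / N) ^ (r + 1) / ((r + 1).factorial : ℝ) *
          X.normOf fun x : ℝ => P.eval (x : ℂ) := by
        refine Finset.sum_le_sum fun r _ => ?_
        rw [X.normOf_const_mul _ (hterm r), X.normOf_norm (memLp_top_eval a b _),
          Complex.norm_real, Real.norm_of_nonneg (by positivity)]
        refine (mul_le_mul_of_nonneg_left (normOf_iterate_derivative_le hab hX (r + 1) hP)
          (by positivity)).trans_eq ?_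
        rw [← mul_assoc, div_mul_eq_mul_div, ← mul_pow]
        have hmul : (b - a) / N * (8 * (n : ℝ) ^ 2 / (b - a)) = 8 * (n : ℝ) ^ 2 / N := by
          field_simp
        rw [hmul]
    _ ≤ _ := by
        rw [← Finset.sum_mul]
        refine mul_le_mul_of_nonneg_right ?_ hP0
        have := Real.sum_le_exp_of_nonneg (x := 8 * (n : ℝ) ^ 2 / N) (by positivity) (n + 1)
        rw [Finset.sum_range_succ'] at this
        simp only [pow_zero, Nat.factorial_zero, Nat.cast_one, div_one] at this
        linarith

theorem normOf_sampleStep_le (hab : a < b) (hX : X.RearrangementInvariant) {n N : ℕ} (hN : 0 < N)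
    {x : ℕ → ℝ} (hx : ∀ k ∈ Finset.Icc 1 N, x k ∈ subInterval a b N k) {P : Polynomial ℂ}
    (hP : P.natDegree ≤ n) :
    X.normOf (sampleStep a b N x P) ≤
      Real.exp (8 * (n : ℝ) ^ 2 / N) * X.normOf fun x : ℝ => P.eval (x : ℂ) := by
  have hp := memLp_top_eval a b P
  have hg := memLp_top_oscMajorant (a := a) (b := b) n P ((b - a) / N)
  have h1 : X.normOf (sampleStep a b N x P) ≤ X.normOf (fun x : ℝ => P.eval (x : ℂ)) +
      X.normOf (fun t => (oscMajorant n P ((b - a) / N) t : ℂ)) := by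
    refine X.normOf_le_add (memLp_top_sampleStep a b N x P) hp hg ?_
    filter_upwards [ae_abs_norm_sampleStep_sub_norm_eval_le hab hN hx hP] with t ht
    rw [Complex.norm_real, Real.norm_eq_abs]
    linarith [(abs_le.1 ht).2, le_abs_self (oscMajorant n P ((b - a) / N) t)]
  linarith [normOf_oscMajorant_le (N := N) hab hX hP]

theorem normOf_eval_le_sampleStep_add (hab : a < b) (hX : X.RearrangementInvariant) {n N : ℕ}
    (hN : 0 < N) {x : ℕ → ℝ} (hx : ∀ k ∈ Finset.Icc 1 N, x k ∈ subInterval a b N k)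
    {P : Polynomial ℂ} (hP : P.natDegree ≤ n) :
    X.normOf (fun x : ℝ => P.eval (x : ℂ)) ≤ X.normOf (sampleStep a b N x P) +
      (Real.exp (8 * (n : ℝ) ^ 2 / N) - 1) * X.normOf fun x : ℝ => P.eval (x : ℂ) := by
  have hs := memLp_top_sampleStep a b N x P
  have hg := memLp_top_oscMajorant (a := a) (b := b) n P ((b - a) / N)
  refine le_trans ?_ (add_le_add_right (normOf_oscMajorant_le (N := N) hab hX hP) _)
  refine X.normOf_le_add (memLp_top_eval a b P) hs hg ?_
  filter_upwards [ae_abs_norm_sampleStep_sub_norm_eval_le hab hN hx hP] with t ht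
  rw [Complex.norm_real, Real.norm_eq_abs]
  linarith [(abs_le.1 ht).1, le_abs_self (oscMajorant n P ((b - a) / N) t)]

end MarcinkiewiczZygmund

/-! ### The two inequalities -/

theorem theorem5p1 :
    -- Markov inequality
    (∀ (a b : ℝ), a < b → ∀ X : BanachFunctionLattice (lebIcc a b), X.RearrangementInvariant →
      ∀ (n r : ℕ) (P : Polynomial ℂ), P.natDegree ≤ n →
        polyFun a b P ∈ X.carrier ∧
        polyFun a b (Polynomial.derivative^[r] P) ∈ X.carrier ∧
        X.nrm (polyFun a b (Polynomial.derivative^[r] P)) ≤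
          (8 * (n : ℝ) ^ 2 / (b - a)) ^ r * X.nrm (polyFun a b P)) ∧
    -- Marcinkiewicz–Zygmund inequality; the constant depends on `ε` only
    (∀ ε : ℝ, 0 < ε → ∃ C : ℝ, 0 < C ∧
      ∀ (a b : ℝ), a < b → ∀ X : BanachFunctionLattice (lebIcc a b), X.RearrangementInvariant →
        ∀ (n N : ℕ), 0 < N → (8 / Real.log 2 + ε) * (n : ℝ) ^ 2 ≤ (N : ℝ) →
          ∀ x : ℕ → ℝ, (∀ k ∈ Finset.Icc 1 N, x k ∈ subInterval a b N k) →
            ∀ P : Polynomial ℂ, P.natDegree ≤ n →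
              polyFun a b P ∈ X.carrier ∧
              sampleFun a b N x P ∈ X.carrier ∧
              X.nrm (polyFun a b P) ≤ C * X.nrm (sampleFun a b N x P) ∧
              X.nrm (sampleFun a b N x P) ≤ C * X.nrm (polyFun a b P)) := by
  constructor
  · intro a b hab X hX n r P hP
    refine ⟨polyFun_mem X P, polyFun_mem X _, ?_⟩
    rw [nrm_polyFun, nrm_polyFun]
    exact normOf_iterate_derivative_le hab hX r hP
  intro ε hε
  have hlog : 0 < Real.log 2 := Real.log_pos one_lt_two
  -- An upper bound for `8 * n ^ 2 / N` that depends only on `ε` and lies strictly below `log 2`.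
  set q := 8 / (8 / Real.log 2 + ε) with hq
  have hK : 0 < 8 / Real.log 2 + ε := by positivity
  have hq2 : q < Real.log 2 := by
    rw [hq, div_lt_iff₀ hK, mul_add, mul_div_cancel₀ _ hlog.ne']
    linarith [mul_pos hlog hε]
  have hE2 : Real.exp q < 2 := (Real.lt_log_iff_exp_lt two_pos).1 hq2
  have hE1 : 1 ≤ Real.exp q := Real.one_le_exp (by positivity)
  have hd : 0 < 2 - Real.exp q := by linarith
  -- Absorbing the error needs `1 / (2 - exp q)`; the numerator `2` makes the constant also dominate
  -- `exp q`, as `1 ≤ exp q < 2`.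
  refine ⟨2 / (2 - Real.exp q), by positivity, ?_⟩
  intro a b hab X hX n N hN hnN x hx P hP
  refine ⟨polyFun_mem X P, sampleFun_mem X N x P, ?_⟩
  have hle : Real.exp (8 * (n : ℝ) ^ 2 / N) ≤ Real.exp q := by
    rw [Real.exp_le_exp, hq, div_le_div_iff₀ (Nat.cast_pos.2 hN) hK]
    linarith
  rw [nrm_polyFun, nrm_sampleFun]
  have hP0 := X.normOf_nonneg (memLp_top_eval a b P)
  have hS0 := X.normOf_nonneg (memLp_top_sampleStep a b N x P)
  have h1 := normOf_sampleStep_le hab hX hN hx hP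
  have h2 := normOf_eval_le_sampleStep_add hab hX hN hx hP
  have h3 := mul_le_mul_of_nonneg_right hle hP0
  constructor
  · rw [div_mul_eq_mul_div, le_div_iff₀ hd]
    linarith
  · refine h1.trans (h3.trans (mul_le_mul_of_nonneg_right ?_ hP0))
    rw [le_div_iff₀ hd]
    nlinarith
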